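/- Let $G=(V,E)$ be a finite simple graph. For $p:V\to\mathbb R^d$ and $u,v\in V$ let $d_{uv}=\frac{p(u)-p(v)}{\|p(u)-p(v)\|}$ if $p(u)\ne p(v)$ and $d_{uv}=0$ otherwise. Let $R(G,p)\in\mathbb R^{d|V|\times|E|}$ be the matrix whose columns are the vectors $(1_u-1_v)\otimes d_{uv}$, $\{u,v\}\in E$, where $\{1_u\}_{u\in V}$ is the standard basis of $\mathbb R^{V}$, and let $L(G,p)=R(G,p)R(G,p)^T$ be the stiffness matrix. Write $\lambda_i(A)$ for the $i$-th smallest eigenvalue (with multiplicity) of a real symmetric matrix $A$. The $d$-dimensional algebraic connectivity of $G$ is $$a_d(G)=\sup\left\{\lambda_{\binom{d+1}{2}+1}(L(G,p)) \;:\; p:V\to\mathbb R^d\right\},$$ and the algebraic connectivity of $G$ is $a(G)=\lambda_2(L(G))$, where $L(G)$ is the graph Laplacian. Theorem. For every $d\ge 2$ and every finite simple graph $G$ with at least $d$ vertices, $$a_d(G)\le a(G).$$ -/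

import Mathlib

noncomputable section

namespace Rigidity

/-- `λ_i(A)`: the `i`-th smallest eigenvalue (`i = 1, 2, …`, counted with multiplicity) of a real
symmetric matrix `A`.  Mathlib's `eigenvalues₀` lists the eigenvalues in decreasing order, so the
`i`-th smallest of `N` eigenvalues has (0-based) position `N - i` there.  If `A` has no `i`-th
smallest eigenvalue, the value is `∞`. -/
def eigenvalue {n : Type*} [Fintype n] [DecidableEq n] {A : Matrix n n ℝ} (hA : A.IsHermitian)
    (i : ℕ) : EReal :=
  if h : 1 ≤ i ∧ i ≤ Fintype.card n then
    ((hA.eigenvalues₀ ⟨Fintype.card n - i, by omega⟩ : ℝ) : EReal)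
  else ⊤

/-- The algebraic connectivity `a(G) = λ₂(L(G))` of a finite graph, where `L(G)` is the graph
Laplacian. -/
def algebraicConnectivity {V : Type*} [Fintype V] [DecidableEq V] (G : SimpleGraph V)
    [DecidableRel G.Adj] : EReal :=
  eigenvalue (G.isHermitian_lapMatrix ℝ) 2

/-- The unit vector `d_{uv}` pointing from `p v` to `p u`, or `0` if `p u = p v`. -/
def direction {V : Type*} {d : ℕ} (p : V → EuclideanSpace ℝ (Fin d)) (u v : V) :
    EuclideanSpace ℝ (Fin d) :=
  open Classical in if p u ≠ p v then ‖p u - p v‖⁻¹ • (p u - p v) else 0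

/-- The vector `(1_u - 1_v) ⊗ d_{uv}`, with coordinates indexed by `V × {1, …, d}`. -/
def edgeVector {V : Type*} [DecidableEq V] {d : ℕ} (p : V → EuclideanSpace ℝ (Fin d)) (u v : V) :
    V × Fin d → ℝ :=
  fun x => (Pi.single u (1 : ℝ) - Pi.single v (1 : ℝ) : V → ℝ) x.1 * direction p u v x.2

theorem direction_swap {V : Type*} {d : ℕ} (p : V → EuclideanSpace ℝ (Fin d)) (u v : V) :
    direction p v u = -direction p u v := by
  unfold direction
  by_cases h : p u = p v
  · simp [h]
  · rw [if_pos (Ne.symm h), if_pos h, norm_sub_rev, ← smul_neg, neg_sub]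

theorem edgeVector_swap {V : Type*} [DecidableEq V] {d : ℕ} (p : V → EuclideanSpace ℝ (Fin d))
    (u v : V) : edgeVector p u v = edgeVector p v u := by
  funext x
  simp only [edgeVector, direction_swap p u v, Pi.sub_apply, PiLp.neg_apply]
  ring

/-- The normalized rigidity matrix `R(G, p)`: its columns are the vectors `(1_u - 1_v) ⊗ d_{uv}`
for the edges `{u, v}` of `G` (they do not depend on the order of `u` and `v`). -/
def rigidityMatrix {V : Type*} [DecidableEq V] (G : SimpleGraph V) {d : ℕ}
    (p : V → EuclideanSpace ℝ (Fin d)) : Matrix (V × Fin d) G.edgeSet ℝ :=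
  Matrix.of fun x e => Sym2.lift ⟨fun u v => edgeVector p u v, edgeVector_swap p⟩ (e : Sym2 V) x

/-- The stiffness matrix `L(G, p) = R(G, p) R(G, p)ᵀ`. -/
def stiffnessMatrix {V : Type*} [Fintype V] [DecidableEq V] (G : SimpleGraph V)
    [DecidableRel G.Adj] {d : ℕ} (p : V → EuclideanSpace ℝ (Fin d)) :
    Matrix (V × Fin d) (V × Fin d) ℝ :=
  rigidityMatrix G p * (rigidityMatrix G p).transpose

theorem isHermitian_stiffnessMatrix {V : Type*} [Fintype V] [DecidableEq V] (G : SimpleGraph V)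
    [DecidableRel G.Adj] {d : ℕ} (p : V → EuclideanSpace ℝ (Fin d)) :
    (stiffnessMatrix G p).IsHermitian := by
  unfold stiffnessMatrix
  rw [← Matrix.conjTranspose_eq_transpose_of_trivial]
  exact Matrix.isHermitian_mul_conjTranspose_self _

/-- The `d`-dimensional algebraic connectivity
`a_d(G) = sup { λ_{binom(d+1,2)+1}(L(G, p)) | p : V → ℝ^d }`. The supremum is taken in the extended
reals, so that an upper bound on it also says that the set is bounded above. -/
def algebraicConnectivityDim (d : ℕ) {V : Type*} [Fintype V] [DecidableEq V] (G : SimpleGraph V)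
    [DecidableRel G.Adj] : EReal :=
  ⨆ p : V → EuclideanSpace ℝ (Fin d),
    eigenvalue (isHermitian_stiffnessMatrix G p) ((d + 1).choose 2 + 1)

end Rigidity

end

namespace Rigidity

open Module

/-! By Courant–Fischer it suffices, for each `p`, to find a space of velocity fields of dimension
`(d + 1).choose 2 + 1` on which the Rayleigh quotient of the stiffness matrix is at most `a = a(G)`.
Let `x ⊥ 1` have Laplacian Rayleigh quotient at most `a`.

If the differences of the points span, take the trivial motions (zero energy) and the field `x ⊗ w`,
whose energy is at most `‖w‖²` times that of `x`, since edge directions have norm at most 1. The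
vector `w` is chosen so that this field is orthogonal to the trivial motions
(`exists_testSpace_of_span_eq_top`).

Otherwise the framework lies in a hyperplane: induct on the dimension, adding the `|V|` independent
normal motions, which cost no energy (`exists_testSpace_of_hyperplane`). -/

theorem exists_mem_ne_zero_of_card_lt_finrank {K M ι : Type*} [Field K] [AddCommGroup M]
    [Module K M] [Fintype ι] (U : Submodule K M) [FiniteDimensional K U] (φ : ι → M →ₗ[K] K)
    (h : Fintype.card ι < finrank K U) : ∃ v ∈ U, v ≠ 0 ∧ ∀ i, φ i v = 0 := by
  have hker : LinearMap.ker ((LinearMap.pi φ).domRestrict U) ≠ ⊥ :=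
    LinearMap.ker_ne_bot_of_finrank_lt (by simpa using h)
  obtain ⟨v, hv, hv0⟩ := Submodule.exists_mem_ne_zero_of_ne_bot hker
  refine ⟨v, v.2, by simpa using hv0, fun i => ?_⟩
  exact congrFun (LinearMap.mem_ker.1 hv) i

/-! ### Variational bounds for eigenvalues. -/

section Eigenvalues

variable {n : Type*} [Fintype n] [DecidableEq n] {A : Matrix n n ℝ}

/-- The coefficient of a vector along the `j`-th eigenvector of a symmetric matrix. -/
noncomputable def eigenCoeff (hA : A.IsHermitian) (j : n) : (n → ℝ) →ₗ[ℝ] ℝ :=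
  (innerₗ (EuclideanSpace ℝ n) (hA.eigenvectorBasis j)) ∘ₗ
    (WithLp.linearEquiv 2 ℝ (n → ℝ)).symm.toLinearMap

theorem eigenCoeff_apply (hA : A.IsHermitian) (j : n) (v : n → ℝ) :
    eigenCoeff hA j v = inner ℝ (hA.eigenvectorBasis j) (WithLp.toLp 2 v) := rfl

theorem eigenCoeff_eq_dotProduct (hA : A.IsHermitian) (j : n) (v : n → ℝ) :
    eigenCoeff hA j v = v ⬝ᵥ (hA.eigenvectorBasis j : n → ℝ) := by
  simp [eigenCoeff_apply, EuclideanSpace.inner_eq_star_dotProduct]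

theorem eigenCoeff_mulVec (hA : A.IsHermitian) (j : n) (v : n → ℝ) :
    eigenCoeff hA j (A.mulVec v) = hA.eigenvalues j * eigenCoeff hA j v := by
  have hT : A.transpose = A := by
    rw [← Matrix.conjTranspose_eq_transpose_of_trivial]; exact hA
  rw [eigenCoeff_eq_dotProduct, eigenCoeff_eq_dotProduct, dotProduct_comm,
    Matrix.dotProduct_mulVec, ← Matrix.mulVec_transpose, hT, hA.mulVec_eigenvectorBasis,
    smul_dotProduct, dotProduct_comm, smul_eq_mul]

theorem dotProduct_eq_sum_eigenCoeff (hA : A.IsHermitian) (v w : n → ℝ) :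
    v ⬝ᵥ w = ∑ j, eigenCoeff hA j v * eigenCoeff hA j w := by
  have h := hA.eigenvectorBasis.sum_inner_mul_inner (WithLp.toLp 2 v) (WithLp.toLp 2 w)
  simp only [eigenCoeff_apply]
  rw [← real_inner_comm, EuclideanSpace.inner_eq_star_dotProduct] at h
  simp only [star_trivial] at h
  rw [← h]
  simp [real_inner_comm]

theorem dotProduct_mulVec_eq_sum_eigenvalues (hA : A.IsHermitian) (v : n → ℝ) :
    v ⬝ᵥ A.mulVec v = ∑ j, hA.eigenvalues j * eigenCoeff hA j v ^ 2 := by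
  rw [dotProduct_eq_sum_eigenCoeff hA]
  refine Finset.sum_congr rfl fun j _ => ?_
  rw [eigenCoeff_mulVec]; ring

theorem dotProduct_self_eq_sum_eigenCoeff (hA : A.IsHermitian) (v : n → ℝ) :
    v ⬝ᵥ v = ∑ j, eigenCoeff hA j v ^ 2 := by
  rw [dotProduct_eq_sum_eigenCoeff hA]
  exact Finset.sum_congr rfl fun j _ => (sq _).symm

/-- The index `j : n` of the eigenvector belonging to the `i`-th eigenvalue in decreasing order. -/
noncomputable def eigenIndex (n : Type*) [Fintype n] : Fin (Fintype.card n) ≃ n :=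
  Fintype.equivOfCardEq (Fintype.card_fin _)

theorem eigenvalues_eigenIndex (hA : A.IsHermitian) (i : Fin (Fintype.card n)) :
    hA.eigenvalues (eigenIndex n i) = hA.eigenvalues₀ i :=
  congrArg hA.eigenvalues₀ ((eigenIndex n).symm_apply_apply i)

/-- The upper bound in the Courant–Fischer theorem. -/
theorem eigenvalues₀_le_of_forall_mem (hA : A.IsHermitian) (i : Fin (Fintype.card n))
    (U : Submodule ℝ (n → ℝ)) (hU : Fintype.card n ≤ finrank ℝ U + i) (a : ℝ)
    (h : ∀ v ∈ U, v ⬝ᵥ A.mulVec v ≤ a * (v ⬝ᵥ v)) : hA.eigenvalues₀ i ≤ a := by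
  -- Kill the components along the eigenvectors after position `i`; only eigenvalues at least the
  -- `i`-th remain.
  obtain ⟨v, hvU, hv0, hv⟩ := exists_mem_ne_zero_of_card_lt_finrank U
    (fun k : Set.Ioi i => eigenCoeff hA (eigenIndex n k)) (by
      have := i.2
      have h1 : Fintype.card (Set.Ioi i) = Fintype.card n - 1 - i := by simp
      omega)
  have hpos : 0 < v ⬝ᵥ v := by
    simpa using Matrix.dotProduct_star_self_pos_iff.2 hv0
  have key : hA.eigenvalues₀ i * (v ⬝ᵥ v) ≤ v ⬝ᵥ A.mulVec v := by
    rw [dotProduct_mulVec_eq_sum_eigenvalues hA, dotProduct_self_eq_sum_eigenCoeff hA,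
      Finset.mul_sum]
    refine Finset.sum_le_sum fun j _ => ?_
    obtain ⟨k, rfl⟩ := (eigenIndex n).surjective j
    rw [eigenvalues_eigenIndex]
    rcases le_or_gt k i with hk | hk
    · exact mul_le_mul_of_nonneg_right (hA.eigenvalues₀_antitone hk) (sq_nonneg _)
    · simp [hv ⟨k, hk⟩]
  exact le_of_mul_le_mul_right (key.trans (h v hvU)) hpos

/-- There is a vector orthogonal to `w` whose Rayleigh quotient is at most the second smallest
eigenvalue. -/
theorem exists_orthogonal_rayleigh_le (hA : A.IsHermitian) (w : n → ℝ)
    (i : Fin (Fintype.card n)) (hi : (i : ℕ) + 2 = Fintype.card n) :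
    ∃ v : n → ℝ, v ≠ 0 ∧ w ⬝ᵥ v = 0 ∧ v ⬝ᵥ A.mulVec v ≤ hA.eigenvalues₀ i * (v ⬝ᵥ v) := by
  -- `none` encodes orthogonality to `w`: in all `i + 1` conditions, one fewer than the dimension.
  obtain ⟨v, -, hv0, hv⟩ := exists_mem_ne_zero_of_card_lt_finrank (⊤ : Submodule ℝ (n → ℝ))
    (fun k : Option (Set.Iio i) => k.elim (dotProductBilin ℝ ℝ w)
      fun k => eigenCoeff hA (eigenIndex n k)) (by
      have h1 : Fintype.card (Set.Iio i) = i := by simp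
      rw [Fintype.card_option, h1, finrank_top, finrank_pi]
      omega)
  refine ⟨v, hv0, by simpa using hv none, ?_⟩
  rw [dotProduct_mulVec_eq_sum_eigenvalues hA, dotProduct_self_eq_sum_eigenCoeff hA,
    Finset.mul_sum]
  refine Finset.sum_le_sum fun j _ => ?_
  obtain ⟨k, rfl⟩ := (eigenIndex n).surjective j
  rw [eigenvalues_eigenIndex]
  rcases le_or_gt i k with hk | hk
  · exact mul_le_mul_of_nonneg_right (hA.eigenvalues₀_antitone hk) (sq_nonneg _)
  · have : eigenCoeff hA (eigenIndex n k) v = 0 := hv (some ⟨k, hk⟩)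
    simp [this]

end Eigenvalues

/-! ### Energy as a quadratic form. -/

/-- The stretching energy `∑ ⟪f u - f v, d_{uv}⟫²` of a velocity field `f`, summed over the ordered
pairs of adjacent vertices. -/
noncomputable def energy {V : Type*} [Fintype V] (G : SimpleGraph V) [DecidableRel G.Adj] {E : Type*}
    [NormedAddCommGroup E] [InnerProductSpace ℝ E] (p f : V → E) : ℝ :=
  ∑ u, ∑ v, if G.Adj u v then (inner ℝ (f u - f v) (‖p u - p v‖⁻¹ • (p u - p v))) ^ 2 else 0

variable {V : Type*} [Fintype V]

/-- Coordinates of a family of vectors, as a vector indexed by `V × Fin d`. -/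
def coords (V : Type*) (d : ℕ) : (V → EuclideanSpace ℝ (Fin d)) ≃ₗ[ℝ] (V × Fin d → ℝ) where
  toFun f x := f x.1 x.2
  invFun g u := WithLp.toLp 2 fun i => g (u, i)
  map_add' _ _ := rfl
  map_smul' _ _ := rfl
  left_inv _ := rfl
  right_inv _ := rfl

theorem coords_apply {V : Type*} {d : ℕ} (f : V → EuclideanSpace ℝ (Fin d)) (x : V × Fin d) :
    coords V d f x = f x.1 x.2 := rfl

theorem coords_dotProduct_self {d : ℕ} (f : V → EuclideanSpace ℝ (Fin d)) :
    coords V d f ⬝ᵥ coords V d f = ∑ u, ‖f u‖ ^ 2 := by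
  simp only [dotProduct, Fintype.sum_prod_type, coords_apply,
    EuclideanSpace.real_norm_sq_eq]
  simp only [sq]

variable [DecidableEq V] (G : SimpleGraph V) [DecidableRel G.Adj]

/-- Each edge underlies exactly two darts; hence the factors 2 in all energy bounds. -/
theorem sum_sum_adj_eq_two_mul_sum_edgeSet (F : Sym2 V → ℝ) :
    (∑ u, ∑ v, if G.Adj u v then F s(u, v) else 0) = 2 * ∑ e : G.edgeSet, F e := by
  have h1 : (∑ d : G.Dart, F d.edge) = ∑ e : G.edgeSet, ∑ d : G.Dart with d.edge = (e : Sym2 V), F d.edge := by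
    have := Finset.sum_fiberwise (Finset.univ : Finset G.Dart)
      (fun d => (⟨d.edge, d.edge_mem⟩ : G.edgeSet)) (fun d => F d.edge)
    rw [← this]
    refine Finset.sum_congr rfl fun e _ => Finset.sum_congr ?_ fun _ _ => rfl
    ext d; simp [Subtype.ext_iff]
  have h2 : (∑ d : G.Dart, F d.edge) = ∑ u, ∑ v, if G.Adj u v then F s(u, v) else 0 := by
    rw [← Finset.sum_product', Finset.univ_product_univ, ← Finset.sum_filter]
    refine Finset.sum_bij (fun d _ => d.toProd) ?_ ?_ ?_ ?_
    · intro d _; simp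
    · intro d _ d' _ h; exact SimpleGraph.Dart.ext _ _ h
    · intro x hx; exact ⟨⟨x, by simpa using hx⟩, Finset.mem_univ _, rfl⟩
    · intro d _; rfl
  rw [← h2, h1, Finset.mul_sum]
  refine Finset.sum_congr rfl fun e _ => ?_
  rw [Finset.sum_congr rfl (g := fun _ => F e) fun d hd => by rw [(Finset.mem_filter.1 hd).2],
    Finset.sum_const, G.dart_edge_fiber_card e e.2]
  simp

theorem coords_dotProduct_edgeVector {d : ℕ} (p f : V → EuclideanSpace ℝ (Fin d)) (u v : V) :
    coords V d f ⬝ᵥ edgeVector p u v =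
      inner ℝ (f u - f v) (‖p u - p v‖⁻¹ • (p u - p v)) := by
  have hdir : direction p u v = ‖p u - p v‖⁻¹ • (p u - p v) := by
    unfold direction
    split_ifs with h
    · rfl
    · simp [not_ne_iff.1 h]
  rw [← hdir]
  simp only [dotProduct, Fintype.sum_prod_type, coords_apply, edgeVector, PiLp.inner_apply]
  rw [Finset.sum_comm]
  refine Finset.sum_congr rfl fun i _ => ?_
  have : ∀ w, f w i * ((Pi.single u (1 : ℝ) - Pi.single v (1 : ℝ) : V → ℝ) w * direction p u v i) =
      (f w i * (Pi.single u (1 : ℝ) : V → ℝ) w) * direction p u v i -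
      (f w i * (Pi.single v (1 : ℝ) : V → ℝ) w) * direction p u v i := by
    intro w; simp only [Pi.sub_apply]; ring
  simp only [this, Finset.sum_sub_distrib, ← Finset.sum_mul]
  simp [Pi.single_apply]
  ring

theorem coords_dotProduct_stiffnessMatrix {d : ℕ} (p f : V → EuclideanSpace ℝ (Fin d)) :
    2 * (coords V d f ⬝ᵥ (stiffnessMatrix G p).mulVec (coords V d f)) = energy G p f := by
  set F : Sym2 V → ℝ := fun e =>
    (coords V d f ⬝ᵥ Sym2.lift ⟨fun u v => edgeVector p u v, edgeVector_swap p⟩ e) ^ 2 with hF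
  have h1 : energy G p f = ∑ u, ∑ v, if G.Adj u v then F s(u, v) else 0 := by
    simp only [energy, hF, Sym2.lift_mk, coords_dotProduct_edgeVector]
  rw [h1, sum_sum_adj_eq_two_mul_sum_edgeSet, stiffnessMatrix, ← Matrix.mulVec_mulVec,
    Matrix.dotProduct_mulVec, Matrix.mulVec_transpose]
  simp only [hF, dotProduct, Matrix.vecMul, rigidityMatrix, Matrix.of_apply, sq]

theorem dotProduct_lapMatrix (x : V → ℝ) :
    2 * (x ⬝ᵥ (G.lapMatrix ℝ).mulVec x) = ∑ u, ∑ v, if G.Adj u v then (x u - x v) ^ 2 else 0 := by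
  rw [← Matrix.toLinearMap₂'_apply', SimpleGraph.lapMatrix_toLinearMap₂']
  ring

/-! ### Skew maps as infinitesimal rotations. -/

section Skew

variable {E : Type*} [NormedAddCommGroup E] [InnerProductSpace ℝ E]

/-- The infinitesimal rotation taking `x` to `y` and `y` to `-x`, for orthonormal `x` and `y`. -/
noncomputable def rotationGenerator (x y : E) : E →ₗ[ℝ] E :=
  (innerₗ E x).smulRight y - (innerₗ E y).smulRight x

theorem rotationGenerator_apply (x y z : E) :
    rotationGenerator x y z = (inner ℝ x z : ℝ) • y - (inner ℝ y z : ℝ) • x := rfl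

/-- Combine the rotation generators of the coordinate planes, indexed by pairs `i < j`; the matrix
entry at `(j, i)` recovers the coefficient, whence injectivity. -/
theorem exists_injective_skew {d : ℕ} (b : OrthonormalBasis (Fin d) ℝ E) :
    ∃ Φ : ((Σ j : Fin d, Fin j) → ℝ) →ₗ[ℝ] (E →ₗ[ℝ] E),
      Function.Injective Φ ∧ ∀ c x, inner ℝ x (Φ c x) = 0 := by
  let ι (σ : Σ j : Fin d, Fin j) : Fin d := σ.2.castLE σ.1.2.le
  have hι (σ : Σ j : Fin d, Fin j) : (ι σ : ℕ) < σ.1 := σ.2.2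
  refine ⟨Fintype.linearCombination ℝ fun σ => rotationGenerator (b (ι σ)) (b σ.1), ?_, ?_⟩
  · refine (injective_iff_map_eq_zero _).2 fun c hc => funext fun σ => ?_
    have h : inner ℝ (b σ.1) (Fintype.linearCombination ℝ
        (fun σ => rotationGenerator (b (ι σ)) (b σ.1)) c (b (ι σ))) = (0 : ℝ) := by
      rw [hc]; simp
    rw [Fintype.linearCombination_apply, LinearMap.sum_apply, inner_sum,
      Finset.sum_eq_single σ] at h
    · have hne : σ.1 ≠ ι σ := fun h => by have := hι σ; rw [← h] at this; omega
      simpa [rotationGenerator_apply, inner_sub_right, inner_smul_right,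
        b.inner_eq_ite, hne, hne.symm] using h
    · intro τ _ hτ
      have h1 : ¬ (ι τ = ι σ ∧ σ.1 = τ.1) := by
        rintro ⟨h1, h2⟩
        apply hτ
        rcases τ with ⟨j, k⟩
        rcases σ with ⟨j', k'⟩
        obtain rfl : j' = j := h2
        have : k = k' := Fin.ext (congrArg (Fin.val (n := d)) h1)
        rw [this]
      have h2 : ¬ (τ.1 = ι σ ∧ σ.1 = ι τ) := by
        rintro ⟨h1, h2⟩
        have := hι τ
        have := hι σ
        rw [← h1, h2] at this
        omega
      simp only [LinearMap.smul_apply, rotationGenerator_apply, inner_sub_right, inner_smul_right,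
        b.inner_eq_ite]
      rcases not_and_or.1 h1 with h1 | h1 <;> rcases not_and_or.1 h2 with h2 | h2 <;>
        simp [h1, h2]
    · simp
  · intro c x
    rw [Fintype.linearCombination_apply, LinearMap.sum_apply, inner_sum]
    refine Finset.sum_eq_zero fun σ _ => ?_
    simp only [LinearMap.smul_apply, rotationGenerator_apply, inner_sub_right, inner_smul_right,
      real_inner_comm x]
    ring

theorem card_sigma_fin (d : ℕ) : Fintype.card (Σ j : Fin d, Fin j) = d.choose 2 := by
  rw [Fintype.card_sigma]
  simp only [Fintype.card_fin]
  rw [Fin.sum_univ_eq_sum_range (fun i => i) d, Finset.sum_range_id, Nat.choose_two_right]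

end Skew

/-! ### Spaces of low-energy motions. -/

section TestSpaces

variable {V : Type*} [Fintype V] (G : SimpleGraph V) [DecidableRel G.Adj]
  {E : Type*} [NormedAddCommGroup E] [InnerProductSpace ℝ E]

theorem sq_inner_normalize_le (w z : E) : (inner ℝ w (‖z‖⁻¹ • z) : ℝ) ^ 2 ≤ ‖w‖ ^ 2 := by
  have h1 : ‖‖z‖⁻¹ • z‖ ≤ 1 := by
    rw [norm_smul, norm_inv, norm_norm]
    exact inv_mul_le_one
  rw [← sq_abs]
  refine pow_le_pow_left₀ (abs_nonneg _) ?_ 2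
  calc _ ≤ ‖w‖ * ‖‖z‖⁻¹ • z‖ := abs_real_inner_le_norm _ _
    _ ≤ ‖w‖ * 1 := by gcongr
    _ = ‖w‖ := mul_one _

/-- Skewness makes `y` itself work unless it vanishes, when any nonzero vector does. Applied to `y =
∑ u, x u • p u`. -/
theorem exists_orthogonal_forall_skew [Nontrivial E] (y : E) :
    ∃ w : E, w ≠ 0 ∧ ∀ A : E →ₗ[ℝ] E, (∀ z, inner ℝ z (A z) = (0 : ℝ)) →
      inner ℝ (A y) w = (0 : ℝ) := by
  by_cases hy : y = 0
  · obtain ⟨w, hw⟩ := exists_ne (0 : E)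
    exact ⟨w, hw, fun A _ => by simp [hy]⟩
  · exact ⟨y, hy, fun A hA => by rw [real_inner_comm, hA]⟩

variable [FiniteDimensional ℝ E]

/-- If the differences of the points `p u` span, the trivial motions together with one vector
`x ⊗ w` orthogonal to them give a space on which the energy is small. -/
theorem exists_testSpace_of_span_eq_top {d : ℕ} (hE : finrank ℝ E = d) (hd : 1 ≤ d)
    {a : ℝ} (ha : 0 ≤ a) {x : V → ℝ} (hx : x ≠ 0) (hx1 : ∑ u, x u = 0)
    (hxa : (∑ u, ∑ v, if G.Adj u v then (x u - x v) ^ 2 else 0) ≤ 2 * (a * ∑ u, x u ^ 2))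
    (p : V → E) (hp : Submodule.span ℝ {z | ∃ u v, z = p u - p v} = ⊤) :
    ∃ U : Submodule ℝ (V → E), (d + 1).choose 2 + 1 ≤ finrank ℝ U ∧
      ∀ f ∈ U, energy G p f ≤ 2 * (a * ∑ u, ‖f u‖ ^ 2) := by
  obtain ⟨Φ, hΦ, hskew⟩ := exists_injective_skew ((stdOrthonormalBasis ℝ E).reindex (finCongr hE))
  have : Nontrivial E := nontrivial_of_finrank_pos (R := ℝ) (by omega)
  obtain ⟨w, hw0, hw⟩ := exists_orthogonal_forall_skew (∑ u, x u • p u)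
  have hwpos : 0 < ‖w‖ ^ 2 := by positivity
  obtain ⟨u₀, hu₀⟩ := Function.ne_iff.1 hx
  have hxpos : 0 < ∑ u, x u ^ 2 :=
    Finset.sum_pos' (fun u _ => sq_nonneg _) ⟨u₀, Finset.mem_univ _, by
      have : x u₀ ≠ 0 := hu₀
      positivity⟩
  let Ψ : (((Σ j : Fin d, Fin j) → ℝ) × E × ℝ) →ₗ[ℝ] (V → E) :=
    { toFun := fun q u => Φ q.1 (p u) + q.2.1 + (q.2.2 * x u) • w
      map_add' := fun q q' => by
        funext u
        simp only [Prod.fst_add, Prod.snd_add, map_add, LinearMap.add_apply, Pi.add_apply]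
        module
      map_smul' := fun s q => by
        funext u
        simp only [Prod.smul_fst, Prod.smul_snd, map_smul, LinearMap.smul_apply, Pi.smul_apply,
          RingHom.id_apply, smul_eq_mul]
        module }
  have hΨ (c b s u) : Ψ (c, b, s) u = Φ c (p u) + b + (s * x u) • w := rfl
  have hnorm (c b s) : ∑ u, ‖Ψ (c, b, s) u‖ ^ 2 =
      ∑ u, ‖Φ c (p u) + b‖ ^ 2 + s ^ 2 * ‖w‖ ^ 2 * ∑ u, x u ^ 2 := by
    -- `∑ u, x u = 0` removes the translation, the choice of `w` the rotation.
    have hcross : ∑ u, inner ℝ (Φ c (p u) + b) ((s * x u) • w) = (0 : ℝ) := by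
      have h1 : ∀ u, inner ℝ (Φ c (p u) + b) ((s * x u) • w) =
          s * (inner ℝ (Φ c (x u • p u)) w + x u * inner ℝ b w) := by
        intro u
        rw [inner_smul_right, inner_add_left, map_smul, real_inner_smul_left]
        ring
      simp only [h1]
      rw [← Finset.mul_sum, Finset.sum_add_distrib, ← Finset.sum_mul, hx1, ← sum_inner,
        ← map_sum, hw _ (hskew c)]
      ring
    simp only [hΨ, norm_add_sq_real (_ + b)]
    rw [Finset.sum_add_distrib, Finset.sum_add_distrib, ← Finset.mul_sum, hcross, Finset.mul_sum]
    simp only [norm_smul, mul_pow, Real.norm_eq_abs, sq_abs, abs_mul]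
    rw [mul_zero, add_zero]
    congr 1
    exact Finset.sum_congr rfl fun u _ => by ring
  have hinj : Function.Injective Ψ := by
    refine (injective_iff_map_eq_zero _).2 ?_
    rintro ⟨c, b, s⟩ h
    have h0 := hnorm c b s
    simp only [h, Pi.zero_apply, norm_zero] at h0
    have hnn : 0 ≤ ∑ u, ‖Φ c (p u) + b‖ ^ 2 := by positivity
    have hs : s = 0 := by
      by_contra hs
      have : 0 < s ^ 2 * ‖w‖ ^ 2 * ∑ u, x u ^ 2 := by positivity
      norm_num at h0
      linarith
    have ht (u) : Φ c (p u) + b = 0 := by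
      have := congrFun h u
      simpa [hΨ, hs] using this
    -- `Φ c` is constant on the points, so it kills their differences, which span.
    have hc : Φ c = 0 := by
      refine LinearMap.ext_on hp ?_
      rintro _ ⟨u, v, rfl⟩
      rw [map_sub, eq_neg_of_add_eq_zero_left (ht u), eq_neg_of_add_eq_zero_left (ht v)]
      simp
    have hb : b = 0 := by simpa [hc] using ht u₀
    have hc' : c = 0 := hΦ (by rw [hc, map_zero])
    simp [hs, hb, hc']
  refine ⟨LinearMap.range Ψ, ?_, ?_⟩
  · rw [LinearMap.finrank_range_of_inj hinj, finrank_prod, finrank_prod, finrank_pi,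
      card_sigma_fin, hE, finrank_self, Nat.choose_succ_succ' d 1, Nat.choose_one_right,
      one_add_one_eq_two]
    omega
  · rintro _ ⟨⟨c, b, s⟩, rfl⟩
    have hterm (u v) : (inner ℝ (Ψ (c, b, s) u - Ψ (c, b, s) v)
        (‖p u - p v‖⁻¹ • (p u - p v)) : ℝ) ^ 2 ≤ s ^ 2 * ‖w‖ ^ 2 * (x u - x v) ^ 2 := by
      have h1 : Ψ (c, b, s) u - Ψ (c, b, s) v =
          Φ c (p u - p v) + (s * (x u - x v)) • w := by
        rw [hΨ, hΨ, map_sub]; module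
      rw [h1, inner_add_left, inner_smul_right _ _ (‖p u - p v‖⁻¹),
        real_inner_comm, hskew, mul_zero, zero_add, real_inner_smul_left, mul_pow]
      calc _ ≤ (s * (x u - x v)) ^ 2 * ‖w‖ ^ 2 := by
            exact mul_le_mul_of_nonneg_left (sq_inner_normalize_le _ _) (sq_nonneg _)
        _ = _ := by ring
    calc energy G p (Ψ (c, b, s))
        ≤ ∑ u, ∑ v, s ^ 2 * ‖w‖ ^ 2 * (if G.Adj u v then (x u - x v) ^ 2 else 0) := by
          refine Finset.sum_le_sum fun u _ => Finset.sum_le_sum fun v _ => ?_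
          split_ifs
          · exact hterm u v
          · simp
      _ = s ^ 2 * ‖w‖ ^ 2 * ∑ u, ∑ v, if G.Adj u v then (x u - x v) ^ 2 else 0 := by
          simp only [Finset.mul_sum]
      _ ≤ s ^ 2 * ‖w‖ ^ 2 * (2 * (a * ∑ u, x u ^ 2)) := by gcongr
      _ ≤ 2 * (a * ∑ u, ‖Ψ (c, b, s) u‖ ^ 2) := by
          rw [hnorm]
          have : 0 ≤ a * ∑ u, ‖Φ c (p u) + b‖ ^ 2 := by positivity
          linarith

/-- A test space for the projection of `p` to the hyperplane `νᗮ` extends by all motions in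
direction `ν`, provided that the framework lies in a translate of that hyperplane. -/
theorem exists_testSpace_of_hyperplane {a : ℝ} (ha : 0 ≤ a) (p : V → E) {ν : E} (hν : ν ≠ 0)
    (hp : ∀ u v, p u - p v ∈ (ℝ ∙ ν)ᗮ) (U' : Submodule ℝ (V → (ℝ ∙ ν)ᗮ))
    (hU' : ∀ f ∈ U', energy G (fun u => (ℝ ∙ ν)ᗮ.orthogonalProjectionOnto (p u)) f ≤
      2 * (a * ∑ u, ‖f u‖ ^ 2)) :
    ∃ U : Submodule ℝ (V → E), finrank ℝ U = finrank ℝ U' + Fintype.card V ∧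
      ∀ f ∈ U, energy G p f ≤ 2 * (a * ∑ u, ‖f u‖ ^ 2) := by
  let Ψ : (U' × (V → ℝ)) →ₗ[ℝ] (V → E) :=
    { toFun := fun q u => ((q.1 : V → (ℝ ∙ ν)ᗮ) u : E) + q.2 u • ν
      map_add' := fun q q' => by
        funext u
        simp only [Prod.fst_add, Prod.snd_add, Submodule.coe_add, Pi.add_apply]
        module
      map_smul' := fun s q => by
        funext u
        simp only [Prod.smul_fst, Prod.smul_snd, Submodule.coe_smul, Pi.smul_apply,
          RingHom.id_apply, smul_eq_mul]
        module }
  have hΨ (f g u) : Ψ (f, g) u = ((f : V → (ℝ ∙ ν)ᗮ) u : E) + g u • ν := rfl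
  have horth (z : (ℝ ∙ ν)ᗮ) : inner ℝ ν (z : E) = (0 : ℝ) :=
    Submodule.mem_orthogonal_singleton_iff_inner_right.1 z.2
  have hnorm (f g u) : ‖Ψ (f, g) u‖ ^ 2 = ‖(f : V → (ℝ ∙ ν)ᗮ) u‖ ^ 2 + ‖g u • ν‖ ^ 2 := by
    rw [hΨ, norm_add_sq_real, inner_smul_right, real_inner_comm, horth]
    simp
  have hinj : Function.Injective Ψ := by
    refine (injective_iff_map_eq_zero _).2 ?_
    rintro ⟨f, g⟩ h
    have h0 (u) : ‖(f : V → (ℝ ∙ ν)ᗮ) u‖ ^ 2 = 0 ∧ ‖g u • ν‖ ^ 2 = 0 := by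
      have := hnorm f g u
      rw [h, Pi.zero_apply, norm_zero, zero_pow two_ne_zero, eq_comm,
        add_eq_zero_iff_of_nonneg (sq_nonneg _) (sq_nonneg _)] at this
      exact this
    have hf : f = 0 := Subtype.ext (funext fun u => by simpa using (h0 u).1)
    have hg : g = 0 := funext fun u => by simpa [hν] using (h0 u).2
    rw [hf, hg]; rfl
  refine ⟨LinearMap.range Ψ, ?_, ?_⟩
  · rw [LinearMap.finrank_range_of_inj hinj, finrank_prod, finrank_pi]
  · rintro _ ⟨⟨f, g⟩, rfl⟩
    have henergy : energy G p (Ψ (f, g)) =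
        energy G (fun u => (ℝ ∙ ν)ᗮ.orthogonalProjectionOnto (p u)) f := by
      refine Finset.sum_congr rfl fun u _ => Finset.sum_congr rfl fun v _ => ?_
      have h1 : (((ℝ ∙ ν)ᗮ.orthogonalProjectionOnto (p u) - (ℝ ∙ ν)ᗮ.orthogonalProjectionOnto (p v) :
          (ℝ ∙ ν)ᗮ) : E) = p u - p v := by
        rw [← map_sub]
        exact Submodule.starProjection_eq_self_iff.2 (hp u v)
      have h2 : Ψ (f, g) u - Ψ (f, g) v =
          (((f : V → (ℝ ∙ ν)ᗮ) u - (f : V → (ℝ ∙ ν)ᗮ) v : (ℝ ∙ ν)ᗮ) : E) + (g u - g v) • ν := by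
        rw [hΨ, hΨ, Submodule.coe_sub]; module
      have h3 : inner ℝ ν (p u - p v) = (0 : ℝ) := horth ⟨_, hp u v⟩
      beta_reduce
      rw [Submodule.coe_norm, Submodule.coe_inner, Submodule.coe_smul, h1, h2, inner_add_left,
        real_inner_smul_left, inner_smul_right ν, h3, mul_zero, mul_zero, add_zero]
    rw [henergy]
    refine (hU' f f.2).trans ?_
    gcongr with u
    rw [← sq_le_sq₀ (norm_nonneg _) (norm_nonneg _), hnorm]
    exact le_add_of_nonneg_right (sq_nonneg _)

end TestSpaces

/-- Induction on the dimension `d + 1`, over abstract spaces `E` so that it applies to hyperplanes.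
-/
theorem exists_testSpace {V : Type*} [Fintype V] (G : SimpleGraph V) [DecidableRel G.Adj]
    (hV2 : 2 ≤ Fintype.card V) {a : ℝ} (ha : 0 ≤ a) {x : V → ℝ} (hx : x ≠ 0)
    (hx1 : ∑ u, x u = 0)
    (hxa : (∑ u, ∑ v, if G.Adj u v then (x u - x v) ^ 2 else 0) ≤ 2 * (a * ∑ u, x u ^ 2))
    (d : ℕ) (hdV : d + 1 ≤ Fintype.card V) (E : Type*) [NormedAddCommGroup E]
    [InnerProductSpace ℝ E] [FiniteDimensional ℝ E] (hE : finrank ℝ E = d + 1) (p : V → E) :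
    ∃ U : Submodule ℝ (V → E), (d + 1 + 1).choose 2 + 1 ≤ finrank ℝ U ∧
      ∀ f ∈ U, energy G p f ≤ 2 * (a * ∑ u, ‖f u‖ ^ 2) := by
  induction d generalizing E with
  | zero =>
    by_cases hp : Submodule.span ℝ {z | ∃ u v, z = p u - p v} = ⊤
    · exact exists_testSpace_of_span_eq_top G hE le_rfl ha hx hx1 hxa p hp
    -- On a line, failure to span means all points coincide, so every motion has zero energy.
    · have h0 : ∀ u v, p u - p v = 0 := by
        intro u v
        by_contra h
        refine hp (top_le_iff.1 ?_)
        rw [← (finrank_eq_one_iff_of_nonzero _ h).1 hE]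
        exact Submodule.span_mono (Set.singleton_subset_iff.2 ⟨u, v, rfl⟩)
      refine ⟨⊤, ?_, fun f _ => ?_⟩
      · rw [finrank_top, finrank_pi_fintype]
        simpa [hE] using hV2
      · have : energy G p f = 0 := by simp [energy, h0]
        rw [this]; positivity
  | succ d ih =>
    by_cases hp : Submodule.span ℝ {z | ∃ u v, z = p u - p v} = ⊤
    · exact exists_testSpace_of_span_eq_top G hE (by omega) ha hx hx1 hxa p hp
    · have hp' := mt (Submodule.orthogonal_eq_bot_iff).1 hp
      obtain ⟨ν, hν, hν0⟩ := Submodule.exists_mem_ne_zero_of_ne_bot hp'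
      have hdiff (u v) : p u - p v ∈ (ℝ ∙ ν)ᗮ :=
        Submodule.mem_orthogonal_singleton_iff_inner_left.2
          (hν _ (Submodule.subset_span ⟨u, v, rfl⟩))
      have : Fact (finrank ℝ E = d + 1 + 1) := ⟨hE⟩
      obtain ⟨U', hdim, hU'⟩ := ih (by omega) (ℝ ∙ ν)ᗮ
        (Submodule.finrank_orthogonal_span_singleton hν0)
        (fun u => (ℝ ∙ ν)ᗮ.orthogonalProjectionOnto (p u))
      obtain ⟨U, hUdim, hU⟩ := exists_testSpace_of_hyperplane G ha p hν0 hdiff U' hU'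
      refine ⟨U, ?_, hU⟩
      -- The binomial grows by `d + 2`, which `hdV` bounds by `|V|`.
      rw [hUdim, Nat.choose_succ_succ' (d + 1 + 1) 1, Nat.choose_one_right, one_add_one_eq_two]
      omega

end Rigidity

theorem theorem1p5 {V : Type*} [Fintype V] [DecidableEq V] (G : SimpleGraph V)
    [DecidableRel G.Adj] (d : ℕ) (hd : 2 ≤ d) (hV : d ≤ Fintype.card V) :
    Rigidity.algebraicConnectivityDim d G ≤ Rigidity.algebraicConnectivity G := by
  open Rigidity in
  have hn2 : 2 ≤ Fintype.card V := hd.trans hV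
  obtain ⟨x, hx0, hx1, hx⟩ := exists_orthogonal_rayleigh_le (G.isHermitian_lapMatrix ℝ) 1
    ⟨Fintype.card V - 2, by omega⟩ (by simp; omega)
  rw [algebraicConnectivity, eigenvalue, dif_pos ⟨one_le_two, hn2⟩]
  set a := (G.isHermitian_lapMatrix ℝ).eigenvalues₀ ⟨Fintype.card V - 2, by omega⟩
  have hxx : x ⬝ᵥ x = ∑ u, x u ^ 2 := by simp only [dotProduct, sq]
  have hxa : (∑ u, ∑ v, if G.Adj u v then (x u - x v) ^ 2 else 0) ≤ 2 * (a * ∑ u, x u ^ 2) := by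
    rw [← dotProduct_lapMatrix, ← hxx]
    linarith
  have ha : 0 ≤ a := by
    have h1 : 0 < x ⬝ᵥ x := by simpa using Matrix.dotProduct_star_self_pos_iff.2 hx0
    have h2 : 0 ≤ ∑ u, ∑ v, if G.Adj u v then (x u - x v) ^ 2 else 0 := by positivity
    rw [← hxx] at hxa
    exact nonneg_of_mul_nonneg_left (by linarith) h1
  refine iSup_le fun p => ?_
  obtain ⟨k, rfl⟩ : ∃ k, d = k + 1 := ⟨d - 1, by omega⟩
  obtain ⟨U, hdim, hU⟩ := exists_testSpace G hn2 ha hx0 (by rwa [← one_dotProduct]) hxa k hV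
    (EuclideanSpace ℝ (Fin (k + 1))) finrank_euclideanSpace_fin p
  set W := U.map (coords V (k + 1)).toLinearMap
  have hW : Module.finrank ℝ W = Module.finrank ℝ U :=
    LinearEquiv.finrank_map_eq (coords V (k + 1)) U
  -- With `hdim`, this puts the eigenvalue index in range, excluding the default `⊤`.
  have hcard : Module.finrank ℝ W ≤ Fintype.card (V × Fin (k + 1)) := by
    simpa using Submodule.finrank_le W
  rw [eigenvalue, dif_pos ⟨by omega, by omega⟩, EReal.coe_le_coe_iff]
  refine eigenvalues₀_le_of_forall_mem _ _ W (by simp only; omega) a ?_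
  rintro _ ⟨f, hf, rfl⟩
  have h1 := hU f hf
  rw [← coords_dotProduct_stiffnessMatrix, ← coords_dotProduct_self] at h1
  exact le_of_mul_le_mul_left h1 two_pos
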